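/- Let $\mathbb{O}=\mathbb{R}^8$ be the octonions, with basis $e_0=1,e_1,\dots,e_7$, where $e_i^2=-1$ for $i\ge1$ and $e_\alpha e_\beta=e_\gamma=-e_\beta e_\alpha$, $e_\beta e_\gamma=e_\alpha=-e_\gamma e_\beta$, $e_\gamma e_\alpha=e_\beta=-e_\alpha e_\gamma$ for $(\alpha,\beta,\gamma)\in\{(1,2,3),(1,4,5),(1,7,6),(2,4,6),(2,5,7),(3,4,7),(3,6,5)\}$. Write $\overline{x}$ and $\mathrm{Re}\,x$ for the conjugate and the real part of $x\in\mathbb{O}$. Let $S^7$ be the unit sphere of $\mathbb{R}^8$, $dS$ its surface area element and $\omega_8$ its surface area. For $f,g\in L^2(S^7)$ (square integrable $\mathbb{O}$-valued functions) put $$(f,g)_{S^7}=\frac{1}{\omega_8}\int_{S^7}\bigl(\overline{\eta g(\eta)}\bigr)\bigl(\eta f(\eta)\bigr)\,dS,\qquad \|f\|_{S^7}^2=(f,f)_{S^7}\in\mathbb{R}.$$ A $C^1$ function $F$ from an open subset of $\mathbb{R}^8$ to $\mathbb{O}$ is called left $\mathbb{O}$-analytic if $\sum_{i=0}^7 e_i\,\frac{\partial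 F}{\partial x_i}=0$. An inner spherical octonionic-analytic of order $k$ is a left $\mathbb{O}$-analytic function on $\mathbb{R}^8$ whose components are homogeneous polynomials of degree $k$; an outer spherical octonionic-analytic of order $k$ is a left $\mathbb{O}$-analytic function on $\mathbb{R}^8\setminus\{0\}$ that is homogeneous of degree $-(k+7)$. **Corollary 3.1.** Let $f\in L^2(S^7)$ have the expansion $$f(\omega)=\sum_{k=0}^\infty\bigl(P_kf(\omega)+Q_kf(\omega)\bigr),\qquad \omega\in S^7,$$ converging in $L^2(S^7)$, where, for each $k\ge 0$, $P_kf$ and $Q_kf$ are respectively an inner and an outer spherical octonionic-analytic of order $k$. Then both series on the right-hand side below converge, and $$\|f\|_{S^7}^2=\sum_{k=0}^\infty\bigl(\|P_kf\|_{S^7}^2+\|Q_kf\|_{S^7}^2\bigr)+\sum_{k=0}^\infty 2\,\mathrm{Re}\,(P_kf,Q_{k+1}f)_{S^7}.$$ -/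

import Mathlib

open MeasureTheory Filter Topology

noncomputable section

namespace Octo

/-- The underlying Euclidean space `ℝ⁸` of the octonions, an element being
`x = x₀ e₀ + x₁ e₁ + ⋯ + x₇ e₇` with `x i` its `i`-th coordinate. The norm is
`|x| = (∑ xᵢ²)^(1/2)`; the octonion product is `Octo.mul`. -/
abbrev 𝕆 : Type := EuclideanSpace ℝ (Fin 8)

/-- The basis octonion `eᵢ`. -/
def e (i : Fin 8) : 𝕆 := EuclideanSpace.single i 1

/-- The seven oriented triples `(α, β, γ)` with `e_α e_β = e_γ` (and cyclically). -/
def W : List (Fin 8 × Fin 8 × Fin 8) :=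
  [(1, 2, 3), (1, 4, 5), (1, 7, 6), (2, 4, 6), (2, 5, 7), (3, 4, 7), (3, 6, 5)]

/-- `(i, j, k)` is a cyclic rotation of a triple in `W`, so that `eᵢ eⱼ = e_k = - eⱼ eᵢ`. -/
abbrev Cyc (i j k : Fin 8) : Prop := (i, j, k) ∈ W ∨ (j, k, i) ∈ W ∨ (k, i, j) ∈ W

/-- Structure constants: `structConst i j k` is the coefficient of `e_k` in `eᵢ eⱼ`. -/
def structConst (i j k : Fin 8) : ℤ :=
  if i = 0 then (if k = j then 1 else 0)
  else if j = 0 then (if k = i then 1 else 0)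
  else if i = j then (if k = 0 then -1 else 0)
  else if Cyc i j k then 1
  else if Cyc j i k then -1
  else 0

/-- The octonion product `x y = ∑ᵢ ∑ⱼ xᵢ yⱼ eᵢ eⱼ`. -/
def mul (x y : 𝕆) : 𝕆 :=
  WithLp.toLp 2 fun k => ∑ i, ∑ j, (structConst i j k : ℝ) * (x i * y j)

/-- The octonion conjugate: `x₀ - x₁ e₁ - ⋯ - x₇ e₇`. -/
def conj (x : 𝕆) : 𝕆 := WithLp.toLp 2 fun k => if k = 0 then x k else -x k

/-- The real (scalar) part `x₀`. -/
def re (x : 𝕆) : ℝ := x 0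

/-- The generalized Cauchy-Riemann operator `D f = ∑ᵢ eᵢ (∂f/∂xᵢ)`, acting from the left. -/
def D (f : 𝕆 → 𝕆) (x : 𝕆) : 𝕆 := ∑ i, mul (e i) (fderiv ℝ f x (e i))

/-- `f` is left `𝕆`-analytic in the (open) set `Ω`: it is of class `C¹` there and `D f = 0`. -/
def LeftAnalyticOn (f : 𝕆 → 𝕆) (Ω : Set 𝕆) : Prop :=
  ContDiffOn ℝ 1 f Ω ∧ ∀ x ∈ Ω, D f x = 0

/-- An inner spherical octonionic-analytic of order `k`: a left `𝕆`-analytic function on `ℝ⁸`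
whose components are homogeneous polynomials of degree `k`. -/
def IsInnerSpherical (k : ℕ) (P : 𝕆 → 𝕆) : Prop :=
  (∃ p : Fin 8 → MvPolynomial (Fin 8) ℝ, (∀ i, (p i).IsHomogeneous k) ∧
    ∀ x i, P x i = MvPolynomial.eval (fun j => x j) (p i)) ∧
  LeftAnalyticOn P Set.univ

/-- An outer spherical octonionic-analytic of order `k`: a left `𝕆`-analytic function on
`ℝ⁸ ∖ {0}` that is homogeneous of degree `-(k + 7)` (its value at `0` plays no role). -/
def IsOuterSpherical (k : ℕ) (Q : 𝕆 → 𝕆) : Prop :=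
  (∀ t : ℝ, 0 < t → ∀ x : 𝕆, x ≠ 0 → Q (t • x) = (t ^ (k + 7))⁻¹ • Q x) ∧
  LeftAnalyticOn Q {0}ᶜ

/-- The unit sphere `S⁷` in `ℝ⁸`. -/
abbrev S7 : Type := Metric.sphere (0 : 𝕆) 1

/-- The surface area measure `dS` on `S⁷`. -/
abbrev dS : Measure S7 := (volume : Measure 𝕆).toSphere

/-- The surface area `ω₈` of `S⁷`. -/
def ω₈ : ℝ := dS.real Set.univ

/-- The octonion-valued inner product
`(f, g) = (1 / ω₈) ∫ conj (η g(η)) (η f(η)) dS(η)` on `L²(S⁷)`. -/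
def sphereInner (f g : S7 → 𝕆) : 𝕆 :=
  ω₈⁻¹ • ∫ η : S7, mul (conj (mul (η : 𝕆) (g η))) (mul (η : 𝕆) (f η)) ∂dS

/-- The induced squared norm `‖f‖² = (f, f)`, as a real number; that `(f, f)` is real is
`sphereInner_self`. -/
def sphereNormSq (f : S7 → 𝕆) : ℝ := re (sphereInner f f)

theorem conj_mul_self (y : 𝕆) : mul (conj y) y = (‖y‖ ^ 2) • e 0 := by
  rw [EuclideanSpace.norm_sq_eq]
  ext k
  fin_cases k <;>
    simp [mul, conj, e, structConst, Cyc, W, Fin.sum_univ_eight] <;> ring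

theorem sphereInner_self (f : S7 → 𝕆) : sphereInner f f = sphereNormSq f • e 0 := by
  have h : sphereInner f f = (ω₈⁻¹ * ∫ η : S7, ‖mul (η : 𝕆) (f η)‖ ^ 2 ∂dS) • e 0 := by
    simp only [sphereInner, conj_mul_self]
    rw [integral_smul_const, smul_smul]
  have h2 : sphereNormSq f = ω₈⁻¹ * ∫ η : S7, ‖mul (η : 𝕆) (f η)‖ ^ 2 ∂dS := by
    rw [sphereNormSq, h]
    simp [re, e]
  rw [h, h2]

/-- The restriction to `S⁷` of a function on `ℝ⁸`. -/
def onSphere (F : 𝕆 → 𝕆) : S7 → 𝕆 := fun ω => F ω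

/-- `f = ∑ₖ (Pₖ + Qₖ)` on `S⁷` is an expansion of `f` in spherical octonionic-analytics, the
series converging in `L²(S⁷)`. -/
structure IsSphericalExpansion (f : S7 → 𝕆) (P Q : ℕ → 𝕆 → 𝕆) : Prop where
  inner_spherical : ∀ k, IsInnerSpherical k (P k)
  outer_spherical : ∀ k, IsOuterSpherical k (Q k)
  tendsto_partialSum : Tendsto
    (fun N : ℕ => eLpNorm
      (fun ω => f ω - ∑ k ∈ Finset.range N, (onSphere (P k) ω + onSphere (Q k) ω)) 2 dS)
    atTop (𝓝 0)

end Octo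

end

/-!
Write `⟨·, ·⟩` for the Euclidean inner product of `ℝ⁸`. Left multiplication by a unit octonion is an
isometry, so the real part of `(f, g)_{S⁷}` is the mean of `⟨f, g⟩` over the sphere, and the
theorem is a statement about the real Hilbert space `L²(S⁷; ℝ⁸)`.

Left `𝕆`-analytic functions that are homogeneous of different degrees are orthogonal there
(`integral_inner_eq_zero`). Inner spherical functions have degree `k ≥ 0` and outer ones degree
`-(k + 7) < 0`, so all the `Pₖ f` and `Qₖ f` are pairwise orthogonal: the real parts
`Re (Pₖ f, Qₖ₊₁ f)` vanish and the identity is Parseval's (`hasSum_norm_sq_of_tendsto`).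

For the orthogonality, let `a` and `b` be analytic, homogeneous of degrees `n` and `m`. Although the
octonions are not associative, left multiplications satisfy the Clifford relations
`⟨p a, q b⟩ + ⟨q a, p b⟩ = 2 ⟨p, q⟩ ⟨a, b⟩` (`inner_mul_add_inner_mul_swap`). With Euler's identity
they show that the vector field `Vᵢ = ⟨eᵢ a, x b⟩ - ⟨eᵢ b, x a⟩` has divergence `2 (m - n) ⟨a, b⟩`;
moreover `∑ xᵢ Vᵢ = 0`, so multiplying `V` by a radial bump function multiplies the divergence by
the same function. The integral over `ℝ⁸` of the resulting divergence is zero, and in polar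
coordinates it is a nonzero multiple of the integral of `⟨a, b⟩` over the sphere.
-/

noncomputable section
namespace Octo

/-! ### Algebra of the octonion product -/

/-- The octonion product as a continuous bilinear map. -/
def mulCLM : 𝕆 →L[ℝ] 𝕆 →L[ℝ] 𝕆 :=
  LinearMap.toContinuousBilinearMap <| LinearMap.mk₂ ℝ mul
    (fun x y z => by
      ext k
      simp only [mul, PiLp.add_apply, ← Finset.sum_add_distrib]
      exact Finset.sum_congr rfl fun i _ => Finset.sum_congr rfl fun j _ => by ring)
    (fun c x y => by
      ext k
      simp only [mul, PiLp.smul_apply, smul_eq_mul, Finset.mul_sum]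
      exact Finset.sum_congr rfl fun i _ => Finset.sum_congr rfl fun j _ => by ring)
    (fun x y z => by
      ext k
      simp only [mul, PiLp.add_apply, ← Finset.sum_add_distrib]
      exact Finset.sum_congr rfl fun i _ => Finset.sum_congr rfl fun j _ => by ring)
    (fun c x y => by
      ext k
      simp only [mul, PiLp.smul_apply, smul_eq_mul, Finset.mul_sum]
      exact Finset.sum_congr rfl fun i _ => Finset.sum_congr rfl fun j _ => by ring)

theorem mulCLM_apply (x y : 𝕆) : mulCLM x y = mul x y := rfl

theorem continuous_conj : Continuous conj := by
  refine (PiLp.continuous_toLp 2 _).comp (continuous_pi fun k => ?_)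
  split_ifs <;> fun_prop

theorem _root_.Continuous.octoMul {X : Type*} [TopologicalSpace X] {f g : X → 𝕆}
    (hf : Continuous f) (hg : Continuous g) : Continuous fun x => mul (f x) (g x) :=
  mulCLM.continuous₂.comp (hf.prodMk hg)

/-- The polarized form of the multiplicativity `|p a| = |p| |a|` of the octonion norm. In terms of
left multiplications it reads `L_pᵀ L_q + L_qᵀ L_p = 2 ⟨p, q⟩`: these are the Clifford relations. -/
theorem inner_mul_add_inner_mul_swap (p q a b : 𝕆) :
    inner ℝ (mul p a) (mul q b) + inner ℝ (mul q a) (mul p b) =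
      2 * inner ℝ p q * inner ℝ a b := by
  simp [PiLp.inner_apply, mul, structConst, Cyc, W, Fin.sum_univ_eight]
  ring

theorem inner_mul_mul_left (p a b : 𝕆) :
    inner ℝ (mul p a) (mul p b) = ‖p‖ ^ 2 * inner ℝ a b := by
  have := inner_mul_add_inner_mul_swap p p a b
  rw [real_inner_self_eq_norm_sq] at this
  linarith

theorem re_conj_mul (y z : 𝕆) : re (mul (conj y) z) = inner ℝ y z := by
  simp [re, PiLp.inner_apply, mul, conj, structConst, Cyc, W, Fin.sum_univ_eight]
  ring

theorem norm_e (i : Fin 8) : ‖e i‖ = 1 := by simp [e]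

theorem inner_e (x : 𝕆) (i : Fin 8) : inner ℝ x (e i) = x i := by
  simp [e, EuclideanSpace.inner_single_right]

theorem sum_coord_smul_e (x : 𝕆) : ∑ i, x i • e i = x := by
  ext k
  simp [e, Finset.sum_apply, Pi.single_apply]

/-! ### The divergence identity -/

theorem fderiv_inner_mul_mul {a b : 𝕆 → 𝕆} {x : 𝕆} (ha : DifferentiableAt ℝ a x)
    (hb : DifferentiableAt ℝ b x) (p v : 𝕆) :
    fderiv ℝ (fun y => inner ℝ (mul p (a y)) (mul y (b y))) x v =
      inner ℝ (mul p (fderiv ℝ a x v)) (mul x (b x)) + inner ℝ (mul p (a x)) (mul v (b x)) +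
        inner ℝ (mul p (a x)) (mul x (fderiv ℝ b x v)) := by
  have h1 : HasFDerivAt (fun y => mul p (a y)) ((mulCLM p).comp (fderiv ℝ a x)) x :=
    (mulCLM p).hasFDerivAt.comp x ha.hasFDerivAt
  have h2 := mulCLM.hasFDerivAt_of_bilinear (hasFDerivAt_id x) hb.hasFDerivAt
  have h3 := h1.inner ℝ h2
  refine (congrArg (· v) h3.fderiv).trans ?_
  simp [mulCLM_apply, inner_add_right]
  ring

theorem differentiableAt_inner_mul_mul {a b : 𝕆 → 𝕆} {x : 𝕆} (ha : DifferentiableAt ℝ a x)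
    (hb : DifferentiableAt ℝ b x) (p : 𝕆) :
    DifferentiableAt ℝ (fun y => inner ℝ (mul p (a y)) (mul y (b y))) x :=
  ((mulCLM p).differentiableAt.comp x ha).inner ℝ
    (mulCLM.hasFDerivAt_of_bilinear (hasFDerivAt_id x) hb.hasFDerivAt).differentiableAt

/-- The divergence of the vector field `(⟨eᵢ a, x b⟩)ᵢ`. -/
theorem sum_fderiv_inner_mul_mul {a b : 𝕆 → 𝕆} {x : 𝕆} (ha : DifferentiableAt ℝ a x)
    (hb : DifferentiableAt ℝ b x) :
    ∑ i, fderiv ℝ (fun y => inner ℝ (mul (e i) (a y)) (mul y (b y))) x (e i) =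
      inner ℝ (D a x) (mul x (b x)) + 8 * inner ℝ (a x) (b x) +
        2 * inner ℝ (a x) (fderiv ℝ b x x) - inner ℝ (mul x (a x)) (D b x) := by
  have key (i : Fin 8) : fderiv ℝ (fun y => inner ℝ (mul (e i) (a y)) (mul y (b y))) x (e i) =
      inner ℝ (mul (e i) (fderiv ℝ a x (e i))) (mul x (b x)) + inner ℝ (a x) (b x) +
        (2 * inner ℝ (a x) (x i • fderiv ℝ b x (e i))
          - inner ℝ (mul x (a x)) (mul (e i) (fderiv ℝ b x (e i)))) := by
    rw [fderiv_inner_mul_mul ha hb, inner_mul_mul_left, norm_e]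
    have := inner_mul_add_inner_mul_swap x (e i) (a x) (fderiv ℝ b x (e i))
    rw [inner_e] at this
    rw [inner_smul_right]
    linarith
  have hx : fderiv ℝ b x x = ∑ i, x i • fderiv ℝ b x (e i) := by
    simp_rw [← map_smul, ← map_sum, sum_coord_smul_e]
  simp only [key, Finset.sum_add_distrib, Finset.sum_sub_distrib, hx, D, sum_inner, inner_sum,
    Finset.mul_sum]
  simp
  ring

/-! ### Homogeneous functions -/

/-- `a` is positively homogeneous of (possibly negative) degree `n` away from the origin. -/
def IsPosHomogeneous (n : ℤ) (a : 𝕆 → 𝕆) : Prop :=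
  ∀ t : ℝ, 0 < t → ∀ x : 𝕆, x ≠ 0 → a (t • x) = t ^ n • a x

/-- **Euler's identity**. -/
theorem IsPosHomogeneous.fderiv_apply_self {n : ℤ} {a : 𝕆 → 𝕆} (h : IsPosHomogeneous n a) {x : 𝕆}
    (hx : x ≠ 0) (ha : DifferentiableAt ℝ a x) : fderiv ℝ a x x = (n : ℝ) • a x := by
  have h1 : HasDerivAt (fun t : ℝ => a (t • x)) (fderiv ℝ a x x) 1 := by
    have h2 : HasFDerivAt a (fderiv ℝ a x) ((1 : ℝ) • x) := by
      rw [one_smul]; exact ha.hasFDerivAt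
    have h3 : HasDerivAt (fun t : ℝ => t • x) ((1 : ℝ) • x) 1 := (hasDerivAt_id 1).smul_const x
    have := h2.comp_hasDerivAt 1 h3
    rwa [one_smul] at this
  have h4 : HasDerivAt (fun t : ℝ => t ^ n • a x) ((n : ℝ) • a x) 1 := by
    simpa using (hasDerivAt_zpow n (1 : ℝ) (Or.inl one_ne_zero)).smul_const (a x)
  refine h1.unique (h4.congr_of_eventuallyEq ?_)
  filter_upwards [lt_mem_nhds (zero_lt_one (α := ℝ))] with t ht using h t ht x hx

/-- The weighted integral over `ℝ⁸` of a homogeneous function, in polar coordinates. -/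
theorem integral_radial_mul_of_homogeneous (w : ℝ → ℝ) {d : ℤ} {u : 𝕆 → ℝ}
    (hu : ∀ t : ℝ, 0 < t → ∀ x : 𝕆, x ≠ 0 → u (t • x) = t ^ d * u x) :
    ∫ x : 𝕆, w ‖x‖ * u x =
      (∫ η : S7, u η ∂dS) *
        ∫ r : Set.Ioi (0 : ℝ), w r * (r : ℝ) ^ d ∂Measure.volumeIoiPow 7 := by
  have hmp := (volume : Measure 𝕆).measurePreserving_homeomorphUnitSphereProd
  have hdim : Module.finrank ℝ 𝕆 - 1 = 7 := by simp
  rw [hdim] at hmp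
  rw [← restrict_compl_singleton (μ := (volume : Measure 𝕆)) 0,
    ← integral_subtype_comap (measurableSet_singleton _).compl (fun x : 𝕆 => w ‖x‖ * u x),
    ← integral_prod_mul,
    ← hmp.integral_comp (Homeomorph.measurableEmbedding _)]
  apply integral_congr_ae
  filter_upwards with x
  have hx : (x : 𝕆) ≠ 0 := x.2
  have hx' : 0 < ‖(x : 𝕆)‖ := norm_pos_iff.mpr hx
  have h := hu ‖(x : 𝕆)‖ hx' (‖(x : 𝕆)‖⁻¹ • (x : 𝕆)) (by simpa using hx)
  rw [smul_inv_smul₀ hx'.ne'] at h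
  simp only [homeomorphUnitSphereProd_apply_fst_coe, homeomorphUnitSphereProd_apply_snd_coe]
  rw [h]
  ring

/-! ### Orthogonality of analytic functions of different degrees -/

/-- A smooth bump function on the shell `1 < |x|² < 3`. It removes the singularity of homogeneous
functions at the origin and gives them compact support. -/
def shellBump : ContDiffBump (2 : ℝ) := ⟨1 / 2, 1, by norm_num, by norm_num⟩

theorem shellBump_eq_zero_of_norm_le {x : 𝕆} (hx : ‖x‖ ≤ 1) : shellBump (‖x‖ ^ 2) = 0 := by
  refine shellBump.zero_of_le_dist ?_
  rw [Real.dist_eq, abs_sub_comm, shellBump]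
  exact (by nlinarith [norm_nonneg x] : (1 : ℝ) ≤ 2 - ‖x‖ ^ 2).trans (le_abs_self _)

theorem shellBump_eq_zero_of_two_le_norm {x : 𝕆} (hx : 2 ≤ ‖x‖) : shellBump (‖x‖ ^ 2) = 0 := by
  refine shellBump.zero_of_le_dist ?_
  rw [Real.dist_eq, shellBump]
  exact (by nlinarith [norm_nonneg x] : (1 : ℝ) ≤ ‖x‖ ^ 2 - 2).trans (le_abs_self _)

theorem shellBump_mul_eventuallyEq_zero (g : 𝕆 → ℝ) :
    (fun x => shellBump (‖x‖ ^ 2) * g x) =ᶠ[𝓝 0] fun _ => 0 := by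
  filter_upwards [Metric.closedBall_mem_nhds (0 : 𝕆) one_pos] with x hx
  rw [shellBump_eq_zero_of_norm_le (by simpa using hx), zero_mul]

theorem hasCompactSupport_shellBump_mul (g : 𝕆 → ℝ) :
    HasCompactSupport fun x => shellBump (‖x‖ ^ 2) * g x :=
  HasCompactSupport.intro (isCompact_closedBall (0 : 𝕆) 2) fun x hx => by
    rw [shellBump_eq_zero_of_two_le_norm (by simpa using (not_le.mp (by simpa using hx)).le),
      zero_mul]

theorem contDiff_shellBump_mul {g : 𝕆 → ℝ} (hg : ContDiffOn ℝ 1 g {0}ᶜ) :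
    ContDiff ℝ 1 fun x => shellBump (‖x‖ ^ 2) * g x := by
  rw [contDiff_iff_contDiffAt]
  intro x
  rcases eq_or_ne x 0 with rfl | hx
  · exact contDiffAt_const.congr_of_eventuallyEq (shellBump_mul_eventuallyEq_zero g)
  · exact (shellBump.contDiff.comp (contDiff_norm_sq ℝ)).contDiffAt.mul
      (hg.contDiffAt (isOpen_compl_singleton.mem_nhds hx))

theorem integral_fderiv_eq_zero {g : 𝕆 → ℝ} (hg : ContDiff ℝ 1 g) (hs : HasCompactSupport g)
    (v : 𝕆) : ∫ x, fderiv ℝ g x v = 0 := by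
  have h := integral_smul_fderiv_eq_neg_fderiv_smul_of_integrable (μ := (volume : Measure 𝕆))
    (f := fun _ => (1 : ℝ)) (g := g) (v := v) (by simp)
    (by simpa using ((hg.continuous_fderiv one_ne_zero).clm_apply
      continuous_const).integrable_of_hasCompactSupport (hs.fderiv_apply ℝ v))
    (by simpa using hg.continuous.integrable_of_hasCompactSupport hs)
    (by fun_prop) (fun x _ => hg.differentiable one_ne_zero x)
  simpa using h

theorem integral_shellBump_radius_pos (d : ℤ) :
    0 < ∫ r : Set.Ioi (0 : ℝ), shellBump ((r : ℝ) ^ 2) * (r : ℝ) ^ d ∂Measure.volumeIoiPow 7 := by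
  have hhom : ∀ t : ℝ, 0 < t → ∀ x : 𝕆, x ≠ 0 → ‖t • x‖ ^ d = t ^ d * ‖x‖ ^ d := by
    intro t ht x _
    rw [norm_smul, Real.norm_of_nonneg ht.le, mul_zpow]
  have h := integral_radial_mul_of_homogeneous (fun r => shellBump (r ^ 2))
    (u := fun x => ‖x‖ ^ d) hhom
  have hcd : ContDiffOn ℝ 1 (fun x : 𝕆 => ‖x‖ ^ d) {0}ᶜ := fun x hx => by
    simp_rw [← Real.rpow_intCast]
    exact ((contDiffAt_norm ℝ hx).rpow_const_of_ne (norm_ne_zero_iff.mpr hx)).contDiffWithinAt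
  have hpos : 0 < ∫ x : 𝕆, shellBump (‖x‖ ^ 2) * ‖x‖ ^ d := by
    refine (contDiff_shellBump_mul hcd).continuous.integral_pos_of_hasCompactSupport_nonneg_nonzero
      (hasCompactSupport_shellBump_mul _) (fun x => mul_nonneg shellBump.nonneg (by positivity))
      (x := Real.sqrt 2 • e 0) ?_
    have hn : ‖Real.sqrt 2 • e 0‖ = Real.sqrt 2 := by simp [norm_smul, norm_e]
    rw [hn, Real.sq_sqrt zero_le_two, shellBump.one_of_mem_closedBall
      (Metric.mem_closedBall_self shellBump.rIn_pos.le)]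
    positivity
  simp only [norm_eq_of_mem_sphere, one_zpow, integral_const, smul_eq_mul, mul_one] at h
  rw [h] at hpos
  exact pos_of_mul_pos_right hpos measureReal_nonneg

/-- Left `𝕆`-analytic functions that are homogeneous of different degrees are orthogonal on the
sphere. The vector field `ψ(|x|²) (⟨eᵢ a, x b⟩ - ⟨eᵢ b, x a⟩)ᵢ` has divergence
`2 (m - n) ψ(|x|²) ⟨a, b⟩` by Euler's identity and the Clifford relations, and compact support. -/
theorem integral_inner_eq_zero {n m : ℤ} (hnm : n ≠ m) {a b : 𝕆 → 𝕆}
    (ha : LeftAnalyticOn a {0}ᶜ) (hb : LeftAnalyticOn b {0}ᶜ)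
    (hna : IsPosHomogeneous n a) (hmb : IsPosHomogeneous m b) :
    ∫ η : S7, inner ℝ (a η) (b η) ∂dS = 0 := by
  set g : Fin 8 → 𝕆 → ℝ := fun i y =>
    inner ℝ (mul (e i) (a y)) (mul y (b y)) - inner ℝ (mul (e i) (b y)) (mul y (a y)) with hg
  have hmul {p q : 𝕆 → 𝕆} (hp : ContDiffOn ℝ 1 p {0}ᶜ) (hq : ContDiffOn ℝ 1 q {0}ᶜ) :
      ContDiffOn ℝ 1 (fun y => mul (p y) (q y)) {0}ᶜ :=
    mulCLM.isBoundedBilinearMap.contDiff.comp_contDiffOn (hp.prodMk hq)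
  have hgc (i : Fin 8) : ContDiffOn ℝ 1 (g i) {0}ᶜ :=
    ((hmul contDiffOn_const ha.1).inner ℝ (hmul contDiffOn_id hb.1)).sub
      ((hmul contDiffOn_const hb.1).inner ℝ (hmul contDiffOn_id ha.1))
  have hdiv (x : 𝕆) : ∑ i, fderiv ℝ (fun y => shellBump (‖y‖ ^ 2) * g i y) x (e i) =
      2 * (m - n) * (shellBump (‖x‖ ^ 2) * inner ℝ (a x) (b x)) := by
    rcases eq_or_ne x 0 with rfl | hx
    · rw [shellBump_eq_zero_of_norm_le (by simp)]
      simp [(shellBump_mul_eventuallyEq_zero _).fderiv_eq]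
    have hnhds : ({0}ᶜ : Set 𝕆) ∈ 𝓝 x := isOpen_compl_singleton.mem_nhds hx
    have hda : DifferentiableAt ℝ a x := (ha.1.contDiffAt hnhds).differentiableAt one_ne_zero
    have hdb : DifferentiableAt ℝ b x := (hb.1.contDiffAt hnhds).differentiableAt one_ne_zero
    have hψ : HasFDerivAt (fun y : 𝕆 => shellBump (‖y‖ ^ 2))
        (deriv shellBump (‖x‖ ^ 2) • (2 • innerSL ℝ x)) x :=
      (shellBump.contDiff.differentiable one_ne_zero _).hasDerivAt.comp_hasFDerivAt x
        (hasStrictFDerivAt_norm_sq x).hasFDerivAt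
    have hgd (i : Fin 8) : DifferentiableAt ℝ (g i) x :=
      ((hgc i).contDiffAt hnhds).differentiableAt one_ne_zero
    have hterm (i : Fin 8) : fderiv ℝ (fun y => shellBump (‖y‖ ^ 2) * g i y) x (e i) =
        shellBump (‖x‖ ^ 2) *
          (fderiv ℝ (fun y => inner ℝ (mul (e i) (a y)) (mul y (b y))) x (e i) -
            fderiv ℝ (fun y => inner ℝ (mul (e i) (b y)) (mul y (a y))) x (e i)) +
          2 * deriv shellBump (‖x‖ ^ 2) * (x i * g i x) := by
      rw [show fderiv ℝ (fun y => shellBump (‖y‖ ^ 2) * g i y) x = _ from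
          (hψ.mul (hgd i).hasFDerivAt).fderiv, show fderiv ℝ (g i) x = _ from fderiv_sub (differentiableAt_inner_mul_mul hda hdb _)
          (differentiableAt_inner_mul_mul hdb hda _)]
      simp [inner_e]
      ring
    -- The radial component of the vector field vanishes, so the derivative of the bump drops out.
    have hrad : ∑ i, x i * g i x = 0 := by
      have hlin (p q : 𝕆) : ∑ i, x i * inner ℝ (mul (e i) p) q = inner ℝ (mul x p) q := by
        conv_rhs => rw [← mulCLM_apply, ← sum_coord_smul_e x]
        simp [sum_inner, inner_smul_left, mulCLM_apply]
      simp only [hg, mul_sub, Finset.sum_sub_distrib, hlin]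
      rw [real_inner_comm, sub_self]
    simp only [hterm, Finset.sum_add_distrib, ← Finset.mul_sum, Finset.sum_sub_distrib, hrad,
      sum_fderiv_inner_mul_mul hda hdb, sum_fderiv_inner_mul_mul hdb hda, ha.2 x hx, hb.2 x hx,
      hna.fderiv_apply_self hx hda, hmb.fderiv_apply_self hx hdb, inner_smul_right,
      inner_zero_left, inner_zero_right, real_inner_comm (a x) (b x)]
    ring
  have hint : ∫ x : 𝕆, shellBump (‖x‖ ^ 2) * inner ℝ (a x) (b x) = 0 := by
    have hz : ∫ x : 𝕆, ∑ i, fderiv ℝ (fun y => shellBump (‖y‖ ^ 2) * g i y) x (e i) = 0 := by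
      rw [integral_finsetSum]
      · exact Finset.sum_eq_zero fun i _ => integral_fderiv_eq_zero
          (contDiff_shellBump_mul (hgc i)) (hasCompactSupport_shellBump_mul _) _
      · exact fun i _ => (((contDiff_shellBump_mul (hgc i)).continuous_fderiv
          one_ne_zero).clm_apply continuous_const).integrable_of_hasCompactSupport
            ((hasCompactSupport_shellBump_mul _).fderiv_apply ℝ _)
    simp only [hdiv] at hz
    rw [integral_const_mul] at hz
    refine (mul_eq_zero.mp hz).resolve_left (mul_ne_zero two_ne_zero (sub_ne_zero.mpr ?_))
    exact_mod_cast hnm.symm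
  have hhom : ∀ t : ℝ, 0 < t → ∀ x : 𝕆, x ≠ 0 →
      inner ℝ (a (t • x)) (b (t • x)) = t ^ (n + m) * inner ℝ (a x) (b x) := by
    intro t ht x hx
    rw [hna t ht x hx, hmb t ht x hx, real_inner_smul_left, real_inner_smul_right,
      zpow_add₀ ht.ne', mul_assoc]
  rw [integral_radial_mul_of_homogeneous (fun r => shellBump (r ^ 2)) hhom] at hint
  exact (mul_eq_zero.mp hint).resolve_right (integral_shellBump_radius_pos _).ne'

/-! ### Spherical octonionic-analytics -/

theorem IsInnerSpherical.leftAnalyticOn {k : ℕ} {P : 𝕆 → 𝕆} (h : IsInnerSpherical k P) :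
    LeftAnalyticOn P {0}ᶜ :=
  ⟨h.2.1.mono (Set.subset_univ _), fun x _ => h.2.2 x (Set.mem_univ x)⟩

theorem IsInnerSpherical.isPosHomogeneous {k : ℕ} {P : 𝕆 → 𝕆} (h : IsInnerSpherical k P) :
    IsPosHomogeneous k P := by
  obtain ⟨⟨p, hp, hP⟩, -⟩ := h
  intro t _ x _
  ext i
  rw [hP, PiLp.smul_apply, hP, MvPolynomial.eval_eq', MvPolynomial.eval_eq', smul_eq_mul,
    Finset.mul_sum]
  refine Finset.sum_congr rfl fun d hd => ?_
  have hdeg : ∑ j, d j = k := by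
    rw [← Finsupp.degree_eq_sum, Finsupp.degree_eq_weight_one]
    exact hp i (MvPolynomial.mem_support_iff.mp hd)
  simp only [PiLp.smul_apply, smul_eq_mul, mul_pow, Finset.prod_mul_distrib,
    Finset.prod_pow_eq_pow_sum, hdeg, zpow_natCast]
  ring

theorem IsOuterSpherical.isPosHomogeneous {k : ℕ} {Q : 𝕆 → 𝕆} (h : IsOuterSpherical k Q) :
    IsPosHomogeneous (-(k + 7 : ℤ)) Q := by
  intro t ht x hx
  rw [h.1 t ht x hx, zpow_neg]
  norm_cast

theorem LeftAnalyticOn.continuous_onSphere {a : 𝕆 → 𝕆} (h : LeftAnalyticOn a {0}ᶜ) :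
    Continuous (onSphere a) :=
  h.1.continuousOn.comp_continuous continuous_subtype_val fun η => ne_zero_of_mem_unit_sphere η

/-! ### The real inner product on `L²(S⁷)` -/

theorem sphereNormSq_eq (f : S7 → 𝕆) :
    sphereNormSq f = ω₈⁻¹ * ∫ η, inner ℝ (f η) (f η) ∂dS := by
  simp only [sphereNormSq, sphereInner, conj_mul_self, ← real_inner_self_eq_norm_sq,
    inner_mul_mul_left, norm_eq_of_mem_sphere, one_pow, one_mul]
  rw [integral_smul_const, smul_smul]
  simp [re, e]

/-- Since left multiplication by a unit octonion is an isometry, the real part of the octonionic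
inner product is the normalized real inner product of `L²(S⁷)`. -/
theorem re_sphereInner {f g : S7 → 𝕆} (hf : Continuous f) (hg : Continuous g) :
    re (sphereInner f g) = ω₈⁻¹ * ∫ η, inner ℝ (g η) (f η) ∂dS := by
  have hc : Continuous fun η : S7 => mul (conj (mul (η : 𝕆) (g η))) (mul (η : 𝕆) (f η)) :=
    (continuous_conj.comp (continuous_subtype_val.octoMul hg)).octoMul
      (continuous_subtype_val.octoMul hf)
  have hi := hc.integrable_of_hasCompactSupport (μ := dS) (HasCompactSupport.of_compactSpace _)
  have h := (EuclideanSpace.proj (𝕜 := ℝ) (0 : Fin 8)).integral_comp_comm hi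
  have h2 (η : S7) : EuclideanSpace.proj (𝕜 := ℝ) (0 : Fin 8)
      (mul (conj (mul (η : 𝕆) (g η))) (mul (η : 𝕆) (f η))) = inner ℝ (g η) (f η) := by
    refine (re_conj_mul _ _).trans ?_
    rw [inner_mul_mul_left, norm_eq_of_mem_sphere, one_pow, one_mul]
  simp only [h2] at h
  rw [h]
  rfl

theorem inner_toLp_toLp {f g : S7 → 𝕆} (hf : MemLp f 2 dS) (hg : MemLp g 2 dS) :
    inner ℝ (hf.toLp f) (hg.toLp g) = ∫ η, inner ℝ (f η) (g η) ∂dS := by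
  rw [L2.inner_def]
  refine integral_congr_ae ?_
  filter_upwards [hf.coeFn_toLp, hg.coeFn_toLp] with η h1 h2
  rw [h1, h2]

theorem sphereNormSq_eq_norm_toLp_sq {f : S7 → 𝕆} (hf : MemLp f 2 dS) :
    sphereNormSq f = ω₈⁻¹ * ‖hf.toLp f‖ ^ 2 := by
  rw [sphereNormSq_eq, ← inner_toLp_toLp hf hf, real_inner_self_eq_norm_sq]

/-- **Parseval's identity** for a convergent series of pairwise orthogonal vectors. -/
theorem hasSum_norm_sq_of_tendsto {H : Type*} [NormedAddCommGroup H] [InnerProductSpace ℝ H]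
    {u : ℕ → H} (hu : Pairwise fun j k => inner ℝ (u j) (u k) = 0) {F : H}
    (hF : Tendsto (fun N => ∑ k ∈ Finset.range N, u k) atTop (𝓝 F)) :
    HasSum (fun k => ‖u k‖ ^ 2) (‖F‖ ^ 2) := by
  rw [hasSum_iff_tendsto_nat_of_nonneg fun k => sq_nonneg _]
  refine (hF.norm.pow 2).congr fun N => ?_
  induction N with
  | zero => simp
  | succ N ih =>
    have h : inner ℝ (∑ k ∈ Finset.range N, u k) (u N) = 0 := by
      rw [sum_inner]
      exact Finset.sum_eq_zero fun k hk => hu (Finset.mem_range.mp hk).ne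
    rw [Finset.sum_range_succ, Finset.sum_range_succ, norm_add_sq_real, h, ih]
    ring

end Octo
end

theorem corollary3p1 (f : Octo.S7 → Octo.𝕆) (hf : MemLp f 2 Octo.dS)
    (P Q : ℕ → Octo.𝕆 → Octo.𝕆) (hPQ : Octo.IsSphericalExpansion f P Q) :
    Summable (fun k => Octo.sphereNormSq (Octo.onSphere (P k)) +
      Octo.sphereNormSq (Octo.onSphere (Q k))) ∧
    Summable (fun k => 2 * Octo.re (Octo.sphereInner (Octo.onSphere (P k))
      (Octo.onSphere (Q (k + 1))))) ∧
    Octo.sphereNormSq f =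
      (∑' k, (Octo.sphereNormSq (Octo.onSphere (P k)) +
        Octo.sphereNormSq (Octo.onSphere (Q k)))) +
      ∑' k, 2 * Octo.re (Octo.sphereInner (Octo.onSphere (P k))
        (Octo.onSphere (Q (k + 1)))) := by
  open Octo in
  have hPa (k) := (hPQ.inner_spherical k).leftAnalyticOn
  have hQa (k) := (hPQ.outer_spherical k).2
  have hPh (k) := (hPQ.inner_spherical k).isPosHomogeneous
  have hQh (k) := (hPQ.outer_spherical k).isPosHomogeneous
  have hLp {a : 𝕆 → 𝕆} (ha : LeftAnalyticOn a {0}ᶜ) : MemLp (onSphere a) 2 dS :=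
    ha.continuous_onSphere.memLp_of_hasCompactSupport (HasCompactSupport.of_compactSpace _)
  let p : ℕ → Lp 𝕆 2 dS := fun k => (hLp (hPa k)).toLp _
  let q : ℕ → Lp 𝕆 2 dS := fun k => (hLp (hQa k)).toLp _
  have hpp {j k : ℕ} (h : j ≠ k) : inner ℝ (p j) (p k) = 0 :=
    (inner_toLp_toLp _ _).trans <|
      integral_inner_eq_zero (by exact_mod_cast h) (hPa j) (hPa k) (hPh j) (hPh k)
  have hqq {j k : ℕ} (h : j ≠ k) : inner ℝ (q j) (q k) = 0 :=
    (inner_toLp_toLp _ _).trans <|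
      integral_inner_eq_zero (by omega) (hQa j) (hQa k) (hQh j) (hQh k)
  -- The degrees `j ≥ 0` and `-(k + 7) < 0` never agree.
  have hqp (k j : ℕ) : inner ℝ (q k) (p j) = 0 :=
    (inner_toLp_toLp _ _).trans <|
      integral_inner_eq_zero (by omega) (hQa k) (hPa j) (hQh k) (hPh j)
  have hcross (k : ℕ) : 2 * re (sphereInner (onSphere (P k)) (onSphere (Q (k + 1)))) = 0 := by
    rw [re_sphereInner (hPa k).continuous_onSphere (hQa (k + 1)).continuous_onSphere,
      ← inner_toLp_toLp (hLp (hQa (k + 1))) (hLp (hPa k))]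
    simp [hqp (k + 1) k, p, q]
  have horth : Pairwise fun j k => inner ℝ (p j + q j) (p k + q k) = 0 := fun j k h => by
    simp only [inner_add_left, inner_add_right, hpp h, hqq h, hqp,
      real_inner_comm (q k) (p j), add_zero]
  have hlim : Tendsto (fun N => ∑ k ∈ Finset.range N, (p k + q k)) atTop (𝓝 (hf.toLp f)) := by
    rw [Lp.tendsto_Lp_iff_tendsto_eLpNorm]
    refine hPQ.tendsto_partialSum.congr fun N => ?_
    rw [← eLpNorm_neg]
    refine eLpNorm_congr_ae ?_
    have hsum (N : ℕ) : ⇑(∑ k ∈ Finset.range N, (p k + q k)) =ᵐ[dS]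
        fun ω => ∑ k ∈ Finset.range N, (onSphere (P k) ω + onSphere (Q k) ω) := by
      induction N with
      | zero =>
        simp only [Finset.range_zero, Finset.sum_empty]
        exact Lp.coeFn_zero 𝕆 2 dS
      | succ N ih =>
        simp only [Finset.sum_range_succ]
        filter_upwards [ih, Lp.coeFn_add (∑ k ∈ Finset.range N, (p k + q k)) (p N + q N),
          Lp.coeFn_add (p N) (q N), (hLp (hPa N)).coeFn_toLp, (hLp (hQa N)).coeFn_toLp]
          with ω h1 h2 h3 h4 h5
        rw [h2, Pi.add_apply, h1, h3, Pi.add_apply, h4, h5]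
    filter_upwards [hsum N] with ω hω
    rw [Pi.sub_apply, hω]
    simp
  have hS := (hasSum_norm_sq_of_tendsto horth hlim).mul_left ω₈⁻¹
  have hterm (k : ℕ) : ω₈⁻¹ * ‖p k + q k‖ ^ 2 =
      sphereNormSq (onSphere (P k)) + sphereNormSq (onSphere (Q k)) := by
    rw [norm_add_sq_real, real_inner_comm, hqp, sphereNormSq_eq_norm_toLp_sq (hLp (hPa k)),
      sphereNormSq_eq_norm_toLp_sq (hLp (hQa k))]
    ring
  simp only [hterm, ← sphereNormSq_eq_norm_toLp_sq hf] at hS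
  simp only [hcross, tsum_zero, add_zero]
  exact ⟨hS.summable, summable_zero, hS.tsum_eq.symm⟩
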